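/- For an integer $n\ge 1$ let $\tau$ be the cyclic permutation of $\{1,\dots,n\}$ with $\tau(1)=n$ and $\tau(i)=i-1$ for $i>1$, and equip $\mathbb{Z}^n$ with the associative multiplication $(x*y)_i = x_i + y_{\tau^{x_i}(i)}$, whose identity is $(0,\dots,0)$. Let $\mathfrak{A}_n$ be the group of invertible elements of the monoid $(\mathbb{Z}^n,*)$. Let $\mathbb{Z}^n\rtimes S_n$ be the semidirect product in which the symmetric group $S_n$ acts on $\mathbb{Z}^n$ by permuting coordinates, $(s\cdot z)_i=z_{s^{-1}(i)}$, permutations being composed from right to left. **Theorem 1.** Let $n\ge 4$. Then $\mathfrak{A}_n\cong \mathbb{Z}^n\rtimes S_n$. The group $\mathbb{Z}^n\rtimes S_n$ is generated by the two elements $$a=\bigl((0,\dots,0,1),\,(1\;2\;\cdots\;n)\bigr),\qquad b=\bigl((0,\dots,0),\,(1\;2)\bigr)$$ (permutations in cycle notation, so that $(1\;2\;\cdots\;n)$ sends $i$ to $i+1$ for $i<n$ and $n$ to $1$), and the following is a complete set of defining relations for these generators: $$b^2=e,\qquad (baba^{-1})^3=e,\qquad (ba^kba^{-k})^2=e\ \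 (2\le k\le n-2),\qquad ba^nba^{-n}=e.$$ That is, the homomorphism from the group presented by the generators $a,b$ and these relations to $\mathbb{Z}^n\rtimes S_n$ which sends the generators to the elements $a,b$ above is an isomorphism. -/

import Mathlib

/-- The lattice `ℤ^V` with the multiplication deformed by a permutation `τ` of `V`:
`(f * g)(v) = f(v) + g(v · τ^{f(v)})`, where `k ∈ ℤ` moves the point `v` to `τ^k(v)`. -/
@[ext]
structure TwistedLattice {V : Type*} (τ : Equiv.Perm V) where
  val : V → ℤ

namespace TwistedLattice

variable {V : Type*} {τ : Equiv.Perm V}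

instance : Mul (TwistedLattice τ) :=
  ⟨fun f g => ⟨fun v => f.val v + g.val ((τ ^ f.val v) v)⟩⟩

instance : One (TwistedLattice τ) := ⟨⟨fun _ => 0⟩⟩

theorem mul_val (f g : TwistedLattice τ) (v : V) :
    (f * g).val v = f.val v + g.val ((τ ^ f.val v) v) := rfl

theorem one_val (v : V) : (1 : TwistedLattice τ).val v = 0 := rfl

instance : Monoid (TwistedLattice τ) where
  mul_assoc f g h := by
    ext v
    simp only [mul_val, add_assoc]
    rw [add_comm (f.val v) (g.val ((τ ^ f.val v) v)), zpow_add, Equiv.Perm.mul_apply]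
  one_mul f := by
    ext v
    simp [mul_val, one_val]
  mul_one f := by
    ext v
    simp [mul_val, one_val]

end TwistedLattice

/-- The group `𝔄_n` of invertible elements of `ℤ^n` with the multiplication deformed by the cyclic
permutation `τ(1) = n`, `τ(i) = i - 1` for `i > 1` (`finRotate n` is `i ↦ i + 1`). -/
abbrev DeformedGroup (n : ℕ) : Type :=
  (TwistedLattice (finRotate n)⁻¹)ˣ

/-- The semidirect product `ℤ^n ⋊ S_n`, where `S_n` acts on `ℤ^n` by permuting the coordinates:
`(s • z)(i) = z(s⁻¹(i))`. -/
abbrev LatticeSemidirectPerm (n : ℕ) : Type :=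
  (Fin n → Multiplicative ℤ) ⋊[mulAutArrow] Equiv.Perm (Fin n)

/-- The element `((0, …, 0, 1), (1 ↦ 2 ↦ ⋯ ↦ n ↦ 1))` of `ℤ^n ⋊ S_n`. Permutations compose from
right to left here; with composition from left to right the same element has the inverse cycle,
with lower row `(n, 1, 2, …, n - 1)`, as its second component. -/
def genA (n : ℕ) : LatticeSemidirectPerm n :=
  ⟨fun i => Multiplicative.ofAdd (if (i : ℕ) + 1 = n then 1 else 0), finRotate n⟩

/-- The element `((0, …, 0), (1 2))` of `ℤ^n ⋊ S_n`. -/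
def genB (n : ℕ) (hn : 4 ≤ n) : LatticeSemidirectPerm n :=
  ⟨1, Equiv.swap ⟨0, by omega⟩ ⟨1, by omega⟩⟩

/-- The relators in the free group on two letters `a = of 0` and `b = of 1`:
`b²`, `(b a b a⁻¹)³`, `(b aᵏ b a⁻ᵏ)²` for `2 ≤ k ≤ n - 2`, and `b aⁿ b a⁻ⁿ`. -/
def relators (n : ℕ) : Set (FreeGroup (Fin 2)) :=
  let a : FreeGroup (Fin 2) := FreeGroup.of 0
  let b : FreeGroup (Fin 2) := FreeGroup.of 1
  {b ^ 2, (b * a * b * a⁻¹) ^ 3} ∪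
    {r | ∃ k : ℕ, 2 ≤ k ∧ k + 2 ≤ n ∧ r = (b * a ^ k * b * (a ^ k)⁻¹) ^ 2} ∪
    {b * a ^ n * b * (a ^ n)⁻¹}

/-! Two independent arguments are involved.

Presentation. Put `s i = a ^ (i - 1) * b * a ^ (1 - i)`. The relators say exactly that the `s i`
satisfy the Coxeter relations of affine type A, with period `n`, while `a` rotates the diagram. Let
W be generated by `s 0, …, s (n - 2)`, and let T be generated by `x 0 = a (s 0 ⋯ s (n - 2))⁻¹` and
its successive conjugates `x (j + 1) = s j * x j * s j`. The `x j` commute (`commute_translation`)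
and are permuted by W under conjugation (`conj_translation_mem`). Hence W normalizes T, and TW is
the whole group because it contains `a` and `b = s 1` (`exists_eq_mul`). In the semidirect product
the `s i` with `i < n - 1` become adjacent transpositions and the `x j` with `j < n` become the unit
translations. A product `t * w` in the kernel first has `w = 1`, since the type A relations force W
to embed in `S_n` (`eq_one_of_map_eq_one`). Then `t = 1`, since T is the image of `ℤ^n` under a
section of the map (`presentationHom_latticeHom`).

The group of units. An element `f` of the deformed lattice acts on `ℤ` by `k ↦ k - f(k mod n)`, and
`f * g` means first `f`, then `g`. Units are the bijections of `ℤ` commuting with translation by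
`n`. Such a bijection is a permutation of the residues together with one integer shift for each
residue, which is a pair in `ℤ^n ⋊ S_n`. -/

/-! ### Coxeter relations of finite type A -/

/-- The Coxeter relations of type `A` for the elements `s 0, …, s (m - 1)`. -/
structure IsBraidSeq {G : Type*} [Group G] (m : ℕ) (s : ℕ → G) : Prop where
  sq : ∀ i, i < m → s i * s i = 1
  braid : ∀ i, i + 1 < m → s i * s (i + 1) * s i = s (i + 1) * s i * s (i + 1)
  comm : ∀ i j, i + 2 ≤ j → j < m → s i * s j = s j * s i

/-- The product `s j * s (j + 1) * ⋯ * s (j + l - 1)`. -/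
def ascProd {G : Type*} [Group G] (s : ℕ → G) (j : ℕ) : ℕ → G
  | 0 => 1
  | l + 1 => ascProd s j l * s (j + l)

theorem ascProd_succ' {G : Type*} [Group G] (s : ℕ → G) (j l : ℕ) :
    ascProd s j (l + 1) = s j * ascProd s (j + 1) l := by
  induction l with
  | zero => simp [ascProd]
  | succ l ih =>
    rw [ascProd, ih, ascProd, mul_assoc]
    congr 3
    omega

theorem ascProd_mem {G : Type*} [Group G] {s : ℕ → G} {H : Subgroup G} {j l : ℕ}
    (h : ∀ i, i < l → s (j + i) ∈ H) : ascProd s j l ∈ H := by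
  induction l with
  | zero => exact H.one_mem
  | succ l ih => exact H.mul_mem (ih fun i hi => h i (by omega)) (h l (by omega))

namespace IsBraidSeq

variable {G : Type*} [Group G] {m : ℕ} {s : ℕ → G}

theorem ascProd_comm_above (h : IsBraidSeq m s) {j l i : ℕ} (hi : j + l + 1 ≤ i) (him : i < m) :
    ascProd s j l * s i = s i * ascProd s j l := by
  induction l with
  | zero => simp [ascProd]
  | succ l ih =>
    rw [ascProd, mul_assoc, h.comm (j + l) i (by omega) him, ← mul_assoc, ih (by omega), mul_assoc]

theorem ascProd_comm_below (h : IsBraidSeq m s) {j l i : ℕ} (hi : i + 2 ≤ j) (hm : j + l ≤ m) :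
    ascProd s j l * s i = s i * ascProd s j l := by
  induction l with
  | zero => simp [ascProd]
  | succ l ih =>
    rw [ascProd, mul_assoc, ← h.comm i (j + l) (by omega) (by omega), ← mul_assoc,
      ih (by omega), mul_assoc]

/-- The product behaves like a cycle, whose conjugation shifts the indices of its letters. Letters
beyond `s (i + 1)` commute with `s i`; the last two remaining letters with `s i` form one side of
the braid relation. -/
theorem ascProd_mul (h : IsBraidSeq m s) {j l i : ℕ} (hj : j ≤ i) (hi : i + 1 < j + l)
    (hm : j + l ≤ m) : ascProd s j l * s i = s (i + 1) * ascProd s j l := by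
  induction l with
  | zero => omega
  | succ l ih =>
    by_cases hil : i + 1 < j + l
    · rw [ascProd, mul_assoc, ← h.comm i (j + l) (by omega) (by omega), ← mul_assoc,
        ih hil (by omega), mul_assoc]
    · obtain ⟨l, rfl⟩ : ∃ l', l = l' + 1 := ⟨l - 1, by omega⟩
      obtain rfl : i = j + l := by omega
      have hb := h.braid (j + l) (by omega)
      have hc := h.ascProd_comm_above (j := j) (l := l) (i := j + l + 1) (by omega) (by omega)
      simp only [ascProd, ← add_assoc]
      calc ascProd s j l * s (j + l) * s (j + l + 1) * s (j + l)
          = ascProd s j l * (s (j + l) * s (j + l + 1) * s (j + l)) := by group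
        _ = ascProd s j l * s (j + l + 1) * (s (j + l) * s (j + l + 1)) := by rw [hb]; group
        _ = _ := by rw [hc]; group

/-- Every element of `⟨s 0, …, s k⟩` lies in a coset of `⟨s 0, …, s (k - 1)⟩` represented by one
of the products `s j ⋯ s k`. -/
theorem exists_eq_ascProd_mul (h : IsBraidSeq m s) {k : ℕ} (hk : k < m) {x : G}
    (hx : x ∈ Subgroup.closure (s '' Set.Iio (k + 1))) :
    ∃ j ≤ k + 1, ∃ y ∈ Subgroup.closure (s '' Set.Iio k), x = ascProd s j (k + 1 - j) * y := by
  have hmem : ∀ i, i < k → s i ∈ Subgroup.closure (s '' Set.Iio k) := fun i hi =>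
    Subgroup.subset_closure ⟨i, hi, rfl⟩
  -- Left multiplication by `s i` permutes the cosets of the representatives `s j ⋯ s k`: it passes
  -- through when `i + 1 < j`, lengthens the product when `i + 1 = j`, cancels its first letter when
  -- `i = j`, and passes through as `s (i - 1)` when `j < i`.
  have step : ∀ i, i < k + 1 → ∀ x,
      (∃ j ≤ k + 1, ∃ y ∈ Subgroup.closure (s '' Set.Iio k), x = ascProd s j (k + 1 - j) * y) →
      ∃ j ≤ k + 1, ∃ y ∈ Subgroup.closure (s '' Set.Iio k),
        s i * x = ascProd s j (k + 1 - j) * y := by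
    rintro i hi _ ⟨j, hj, y, hy, rfl⟩
    rcases lt_trichotomy i j with hij | rfl | hij
    · by_cases hij' : i + 1 = j
      · refine ⟨i, by omega, y, hy, ?_⟩
        obtain ⟨l, rfl⟩ : ∃ l, k = i + l := ⟨k - i, by omega⟩
        subst hij'
        rw [show i + l + 1 - i = l + 1 by omega, ascProd_succ',
          show i + l + 1 - (i + 1) = l by omega, mul_assoc]
      · refine ⟨j, hj, s i * y, mul_mem (hmem i (by omega)) hy, ?_⟩
        rw [← mul_assoc, ← mul_assoc, h.ascProd_comm_below (by omega) (by omega)]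
    · refine ⟨i + 1, by omega, y, hy, ?_⟩
      obtain ⟨l, rfl⟩ : ∃ l, k = i + l := ⟨k - i, by omega⟩
      rw [show i + l + 1 - i = l + 1 by omega, ascProd_succ',
          show i + l + 1 - (i + 1) = l by omega, ← mul_assoc, ← mul_assoc, h.sq i (by omega),
          one_mul]
    · obtain ⟨i, rfl⟩ : ∃ i', i = i' + 1 := ⟨i - 1, by omega⟩
      refine ⟨j, hj, s i * y, mul_mem (hmem i (by omega)) hy, ?_⟩
      rw [← mul_assoc, ← mul_assoc, h.ascProd_mul (by omega) (by omega) (by omega)]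
  induction hx using Subgroup.closure_induction_left with
  | one => exact ⟨k + 1, le_rfl, 1, one_mem _, by simp [ascProd]⟩
  | mul_left g hg y _ ih =>
    obtain ⟨i, hi, rfl⟩ := hg
    exact step i hi y ih
  | inv_mul_cancel g hg y _ ih =>
    obtain ⟨i, hi, rfl⟩ := hg
    rw [inv_eq_of_mul_eq_one_left (h.sq i (lt_of_lt_of_le hi (by omega)))]
    exact step i hi y ih

/-- A homomorphism to a symmetric group taking the `s i` to adjacent transpositions is injective
on the subgroup they generate. -/
theorem eq_one_of_map_eq_one (h : IsBraidSeq m s) {α : Type*} [DecidableEq α]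
    (φ : G →* Equiv.Perm α) {p : ℕ → α} (hp : Set.InjOn p (Set.Iic m))
    (hφ : ∀ i, i < m → φ (s i) = Equiv.swap (p i) (p (i + 1))) {k : ℕ} (hk : k ≤ m) {x : G}
    (hx : x ∈ Subgroup.closure (s '' Set.Iio k)) (h1 : φ x = 1) : x = 1 := by
  induction k generalizing x with
  | zero => simpa using hx
  | succ k ih =>
    obtain ⟨j, hj, y, hy, rfl⟩ := h.exists_eq_ascProd_mul (by omega) hx
    -- The factor `y` fixes `p (k + 1)`, while the representative `s j ⋯ s k` sends `p (k + 1)` to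
    -- `p j`. A trivial image therefore forces `j = k + 1`, an empty product, and the induction
    -- applies to `y`.
    have hfix : φ y (p (k + 1)) = p (k + 1) := by
      have hle : Subgroup.closure (s '' Set.Iio k) ≤
          (MulAction.stabilizer (Equiv.Perm α) (p (k + 1))).comap φ := by
        rw [Subgroup.closure_le]
        rintro _ ⟨i, hi, rfl⟩
        have hi : i < k := hi
        change φ (s i) (p (k + 1)) = p (k + 1)
        rw [hφ i (by omega)]
        apply Equiv.swap_apply_of_ne_of_ne
        · exact fun he => absurd (hp (by simp; omega) (by simp; omega) he) (by omega)
        · exact fun he => absurd (hp (by simp; omega) (by simp; omega) he) (by omega)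
      exact hle hy
    have hasc : ∀ l, j + l ≤ m → φ (ascProd s j l) (p (j + l)) = p j := by
      intro l hl
      induction l with
      | zero => simp [ascProd]
      | succ l ih =>
        rw [ascProd, map_mul, hφ _ (by omega), Equiv.Perm.mul_apply, ← add_assoc,
          Equiv.swap_apply_right, ih (by omega)]
    have hjk : j = k + 1 := by
      have h2 := congrArg (fun π : Equiv.Perm α => π (p (k + 1))) h1
      simp only [map_mul, Equiv.Perm.mul_apply, hfix, Equiv.Perm.one_apply] at h2
      have h3 := hasc (k + 1 - j) (by omega)
      rw [Nat.add_sub_cancel' hj, h2] at h3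
      exact (hp (by simp; omega) (by simp; omega) h3).symm
    subst hjk
    simp only [Nat.sub_self, ascProd, one_mul] at h1 ⊢
    exact ih (by omega) hy h1

end IsBraidSeq

/-! ### Affine relations with a rotation, and the commuting translations -/

/-- The Coxeter relations of affine type `A` for `s`, whose diagram is rotated by `a`. -/
structure IsRotatedBraidSeq {G : Type*} [Group G] (n : ℕ) (a : G) (s : ℕ → G) : Prop where
  sq : ∀ i, s i * s i = 1
  braid : ∀ i, s i * s (i + 1) * s i = s (i + 1) * s i * s (i + 1)
  comm : ∀ i k, 2 ≤ k → k + 2 ≤ n → s i * s (i + k) = s (i + k) * s i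
  conj : ∀ i, a * s i = s (i + 1) * a
  period : ∀ i, s (i + n) = s i

/-- The translations `x 0 = a (s 0 ⋯ s (n - 2))⁻¹` and `x (j + 1) = s j * x j * s j`. -/
def translationSeq {G : Type*} [Group G] (n : ℕ) (a : G) (s : ℕ → G) : ℕ → G
  | 0 => a * (ascProd s 0 (n - 1))⁻¹
  | j + 1 => s j * translationSeq n a s j * s j

namespace IsRotatedBraidSeq

variable {G : Type*} [Group G] {n : ℕ} {a : G} {s : ℕ → G}

theorem isBraidSeq (h : IsRotatedBraidSeq n a s) : IsBraidSeq (n - 1) s where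
  sq i _ := h.sq i
  braid i _ := h.braid i
  comm i j hij hj := by
    obtain ⟨k, rfl⟩ := Nat.exists_eq_add_of_le hij
    rw [add_assoc]
    exact h.comm i (2 + k) (by omega) (by omega)

local notation "x" => translationSeq n a s

/-- Both `a` and `s 0 ⋯ s (n - 2)` conjugate `s (i - 1)` to `s i`, so their quotient `x 0`
centralizes `s i`. -/
theorem commute_translation_zero (h : IsRotatedBraidSeq n a s) {i : ℕ} (hi : 1 ≤ i)
    (hin : i + 1 < n) : Commute (s i) (x 0) := by
  obtain ⟨i, rfl⟩ : ∃ i', i = i' + 1 := ⟨i - 1, by omega⟩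
  have hc := h.isBraidSeq.ascProd_mul (j := 0) (l := n - 1) (i := i) (by omega) (by omega)
    (by omega)
  rw [commute_iff_eq, translationSeq, ← mul_assoc, ← h.conj, mul_assoc, mul_assoc]
  congr 1
  rw [mul_inv_eq_iff_eq_mul, mul_assoc, ← hc, inv_mul_cancel_left]

theorem commute_translation_above (h : IsRotatedBraidSeq n a s) {i j : ℕ} (hi : j + 1 ≤ i)
    (hin : i + 1 < n) : Commute (s i) (x j) := by
  induction j with
  | zero => exact h.commute_translation_zero hi hin
  | succ j ih =>
    have hc : Commute (s i) (s j) := (h.isBraidSeq.comm j i (by omega) (by omega)).symm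
    exact (hc.mul_right (ih (by omega))).mul_right hc

theorem commute_translation_below (h : IsRotatedBraidSeq n a s) {i j : ℕ} (hi : i + 2 ≤ j)
    (hjn : j < n) : Commute (s i) (x j) := by
  induction j with
  | zero => omega
  | succ j ih =>
    by_cases hij : i + 2 ≤ j
    · have hc : Commute (s i) (s j) := h.isBraidSeq.comm i j (by omega) (by omega)
      exact (hc.mul_right (ih hij (by omega))).mul_right hc
    -- Here `x (i + 2)` is `x i` conjugated by `s (i + 1) * s i`. The braid relation turns `s i`
    -- into `s (i + 1)` on its way past that word, and `s (i + 1)` commutes with `x i`.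
    · obtain rfl : j = i + 1 := by omega
      have hb := h.braid i
      have hc : s (i + 1) * x i = x i * s (i + 1) :=
        h.commute_translation_above (i := i + 1) (j := i) le_rfl (by omega)
      rw [commute_iff_eq, translationSeq, translationSeq]
      calc s i * (s (i + 1) * (s i * x i * s i) * s (i + 1))
          = (s i * s (i + 1) * s i) * x i * s i * s (i + 1) := by group
        _ = s (i + 1) * s i * (s (i + 1) * x i) * s i * s (i + 1) := by rw [hb]; group
        _ = s (i + 1) * s i * x i * (s (i + 1) * s i * s (i + 1)) := by rw [hc]; group
        _ = s (i + 1) * (s i * x i * s i) * s (i + 1) * s i := by rw [← hb]; group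

theorem mul_ascProd_eq_of_shift {g : G} {j k l : ℕ}
    (hg : ∀ i, i < l → g * s (j + i) = s (k + i) * g) :
    g * ascProd s j l = ascProd s k l * g := by
  induction l with
  | zero => simp [ascProd]
  | succ l ih =>
    rw [ascProd, ascProd, ← mul_assoc, ih fun i hi => hg i (by omega), mul_assoc,
      hg l (by omega), mul_assoc]

/-- The base case for all commutations, and the one that needs the period. Both products of the
inverses of `x 0` and `x 1` reduce to `(s 1 ⋯ s N)(s 0 ⋯ s (N - 1)) a⁻²` with `N = n - 2`. -/
theorem commute_translation_zero_one (h : IsRotatedBraidSeq n a s) (hn : 3 ≤ n) :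
    Commute (x 0) (x 1) := by
  obtain ⟨N, rfl⟩ : ∃ N, n = N + 2 := ⟨n - 2, by omega⟩
  have hinv : ∀ i, (s i)⁻¹ = s i := fun i => inv_eq_of_mul_eq_one_left (h.sq i)
  have hC : ascProd s 0 (N + 1) * ascProd s 0 N = ascProd s 1 N * ascProd s 0 (N + 1) :=
    mul_ascProd_eq_of_shift fun i hi => by
      simpa [add_comm 1 i] using
        h.isBraidSeq.ascProd_mul (j := 0) (l := N + 1) (i := i) (by omega) (by omega) (by omega)
  have ha : a * ascProd s 0 N = ascProd s 1 N * a :=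
    mul_ascProd_eq_of_shift fun i _ => by simpa [add_comm 1 i] using h.conj i
  -- Two rotations take `s N` to `s (N + 2) = s n`, which is `s 0` by periodicity.
  have haN : a * a * s N = s 0 * (a * a) := by
    rw [mul_assoc, h.conj, ← mul_assoc, h.conj, ← h.period 0, mul_assoc, zero_add]
  have hsucc : ascProd s 0 (N + 1) = ascProd s 0 N * s N := by rw [ascProd, zero_add]
  have hsucc' : ascProd s 0 (N + 1) = s 0 * ascProd s 1 N := ascProd_succ' s 0 N
  have ha' : a⁻¹ * ascProd s 1 N = ascProd s 0 N * a⁻¹ := by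
    rw [inv_mul_eq_iff_eq_mul, ← mul_assoc, ha, mul_inv_cancel_right]
  have haN' : a⁻¹ * a⁻¹ * s 0 = s N * (a⁻¹ * a⁻¹) := by
    rw [← mul_inv_rev, inv_mul_eq_iff_eq_mul, ← mul_assoc, haN, mul_inv_cancel_right]
  have h0 : (translationSeq (N + 2) a s 0)⁻¹ = ascProd s 0 (N + 1) * a⁻¹ := by simp [translationSeq]
  have h1 : (translationSeq (N + 2) a s 1)⁻¹ = ascProd s 1 N * a⁻¹ * s 0 := by
    rw [translationSeq, mul_inv_rev, mul_inv_rev, h0, hinv, hsucc', ← mul_assoc, ← mul_assoc,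
      ← mul_assoc, h.sq, one_mul]
  rw [← Commute.inv_inv_iff, commute_iff_eq]
  trans ascProd s 1 N * ascProd s 0 N * (a⁻¹ * a⁻¹)
  · rw [h0, h1]
    calc ascProd s 0 (N + 1) * a⁻¹ * (ascProd s 1 N * a⁻¹ * s 0)
        = ascProd s 0 (N + 1) * (a⁻¹ * ascProd s 1 N) * a⁻¹ * s 0 := by group
      _ = (ascProd s 0 (N + 1) * ascProd s 0 N) * (a⁻¹ * a⁻¹ * s 0) := by rw [ha']; group
      _ = ascProd s 1 N * ascProd s 0 N * (s N * s N) * (a⁻¹ * a⁻¹) := by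
        rw [hC, haN', hsucc]; group
      _ = _ := by rw [h.sq, mul_one]
  · symm
    rw [h0, h1]
    calc ascProd s 1 N * a⁻¹ * s 0 * (ascProd s 0 (N + 1) * a⁻¹)
        = ascProd s 1 N * a⁻¹ * (s 0 * s 0) * ascProd s 1 N * a⁻¹ := by rw [hsucc']; group
      _ = ascProd s 1 N * (a⁻¹ * ascProd s 1 N) * a⁻¹ := by rw [h.sq]; group
      _ = _ := by rw [ha']; group

/-- Everything is conjugate to the pair `x 0`, `x 1`: `j` is raised by conjugating with `s j`, which
centralizes `x 0` for `j ≥ 1`, and then `i` is raised with `s i`, which centralizes `x j` for `i + 2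
≤ j`. -/
theorem commute_translation (h : IsRotatedBraidSeq n a s) (hn : 3 ≤ n) {i j : ℕ} (hij : i < j)
    (hj : j < n) : Commute (x i) (x j) := by
  induction i with
  | zero =>
    induction j with
    | zero => omega
    | succ j ih =>
      rcases Nat.eq_zero_or_pos j with rfl | hj0
      · exact h.commute_translation_zero_one hn
      · have hc : Commute (x 0) (s j) := (h.commute_translation_zero hj0 hj).symm
        exact (hc.mul_right (ih (by omega) (by omega))).mul_right hc
  | succ i ih =>
    have hc : Commute (s i) (x j) := h.commute_translation_below hij hj
    exact (hc.mul_left (ih (by omega))).mul_left hc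

theorem conj_translation_mem (h : IsRotatedBraidSeq n a s) {i j : ℕ} (hi : i + 1 < n) (hj : j < n) :
    ∃ k, k < n ∧ s i * x j * s i = x k := by
  rcases lt_trichotomy i j with hij | rfl | hij
  · by_cases hij' : i + 1 = j
    · subst hij'
      refine ⟨i, by omega, ?_⟩
      rw [translationSeq]
      calc s i * (s i * x i * s i) * s i = (s i * s i) * x i * (s i * s i) := by group
        _ = x i := by simp [h.sq]
    · refine ⟨j, hj, ?_⟩
      rw [(h.commute_translation_below (i := i) (j := j) (by omega) hj).eq, mul_assoc, h.sq,
        mul_one]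
  · exact ⟨i + 1, hi, rfl⟩
  · refine ⟨j, hj, ?_⟩
    rw [(h.commute_translation_above (i := i) (j := j) (by omega) hi).eq, mul_assoc, h.sq,
        mul_one]

/-- The group is the product of the translations and of `⟨s 0, …, s (n - 2)⟩`. -/
theorem exists_eq_mul (h : IsRotatedBraidSeq n a s) (hn : 3 ≤ n) (g : G)
    (hg : g ∈ Subgroup.closure {a, s 1}) :
    ∃ t ∈ Subgroup.closure (x '' Set.Iio n), ∃ w ∈ Subgroup.closure (s '' Set.Iio (n - 1)),
      g = t * w := by
  -- Once W normalizes T, the join of T and W is the set of products TW, so only membership of the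
  -- two generators in the join remains to be checked.
  have hnorm : Subgroup.closure (s '' Set.Iio (n - 1)) ≤
      Subgroup.normalizer (Subgroup.closure (x '' Set.Iio n) : Set G) := by
    rw [Subgroup.closure_le]
    rintro _ ⟨i, hi, rfl⟩
    have hi : i < n - 1 := hi
    have hinv : (s i)⁻¹ = s i := inv_eq_of_mul_eq_one_left (h.sq i)
    have hle : ∀ t ∈ Subgroup.closure (x '' Set.Iio n),
        s i * t * (s i)⁻¹ ∈ Subgroup.closure (x '' Set.Iio n) := by
      have : Subgroup.closure (x '' Set.Iio n) ≤
          (Subgroup.closure (x '' Set.Iio n)).comap (MulAut.conj (s i)).toMonoidHom := by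
        refine (Subgroup.closure_le
          ((Subgroup.closure (x '' Set.Iio n)).comap (MulAut.conj (s i)).toMonoidHom)).2 ?_
        rintro _ ⟨j, hj, rfl⟩
        obtain ⟨k, hk, he⟩ := h.conj_translation_mem (i := i) (by omega) hj
        refine Subgroup.subset_closure ⟨k, hk, ?_⟩
        simp [hinv, he]
      exact fun t ht => this ht
    rw [SetLike.mem_coe, Subgroup.mem_normalizer_iff]
    refine fun t => ⟨hle t, fun ht => ?_⟩
    have := hle _ ht
    rw [hinv] at this
    rwa [show s i * (s i * t * s i) * s i = (s i * s i) * t * (s i * s i) by group, h.sq, one_mul,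
      mul_one] at this
  have hle : Subgroup.closure {a, s 1} ≤
      Subgroup.closure (x '' Set.Iio n) ⊔ Subgroup.closure (s '' Set.Iio (n - 1)) := by
    have hs : ∀ i, i < n - 1 → s i ∈ Subgroup.closure (s '' Set.Iio (n - 1)) := fun i hi =>
      Subgroup.subset_closure ⟨i, hi, rfl⟩
    rw [Subgroup.closure_le]
    rintro g (hg | hg) <;> rw [hg]
    · have h0 : x 0 ∈ Subgroup.closure (x '' Set.Iio n) :=
        Subgroup.subset_closure ⟨0, by simp; omega, rfl⟩
      have hc : ascProd s 0 (n - 1) ∈ Subgroup.closure (s '' Set.Iio (n - 1)) :=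
        ascProd_mem fun i hi => hs _ (by omega)
      have := Subgroup.mul_mem_sup h0 hc
      simpa [translationSeq] using this
    · exact Subgroup.mem_sup_right (hs 1 (by omega))
  have hg' := hle hg
  rw [← SetLike.mem_coe, Subgroup.coe_mul_of_right_le_normalizer_left _ _ hnorm] at hg'
  obtain ⟨t, ht, w, hw, rfl⟩ := hg'
  exact ⟨t, ht, w, hw, rfl⟩

end IsRotatedBraidSeq

/-! ### From the relators to the affine Coxeter relations -/

/-- The conjugates `a ^ (i - 1) * b * a ^ (1 - i)`. -/
def conjSeq {G : Type*} [Group G] (a b : G) (i : ℕ) : G := MulAut.conj (a ^ ((i : ℤ) - 1)) b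

theorem conjSeq_add {G : Type*} [Group G] (a b : G) (i k : ℕ) :
    conjSeq a b (i + k) = MulAut.conj (a ^ k) (conjSeq a b i) := by
  rw [conjSeq, conjSeq, ← MulAut.mul_apply, ← map_mul, ← zpow_natCast, ← zpow_add]
  congr 3
  push_cast
  ring

theorem conjSeq_one {G : Type*} [Group G] (a b : G) : conjSeq a b 1 = b := by
  simp [conjSeq]

theorem conjSeq_succ_eq {G : Type*} [Group G] (a b : G) (i : ℕ) :
    conjSeq a b (i + 1) = a ^ i * b * (a ^ i)⁻¹ := by
  rw [add_comm, conjSeq_add, conjSeq_one, MulAut.conj_apply]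

theorem conjSeq_succ {G : Type*} [Group G] (a b : G) (i : ℕ) :
    conjSeq a b (i + 1) = a * conjSeq a b i * a⁻¹ := by
  rw [conjSeq_add, pow_one, MulAut.conj_apply]

theorem map_conjSeq {G H : Type*} [Group G] [Group H] (φ : G →* H) (a b : G) (i : ℕ) :
    φ (conjSeq a b i) = conjSeq (φ a) (φ b) i := by
  rw [conjSeq, conjSeq, MulAut.conj_apply, MulAut.conj_apply]
  simp

theorem map_ascProd {G H : Type*} [Group G] [Group H] (φ : G →* H) (s : ℕ → G) (j l : ℕ) :
    φ (ascProd s j l) = ascProd (fun i => φ (s i)) j l := by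
  induction l with
  | zero => simp [ascProd]
  | succ l ih => simp [ascProd, ih]

/-- Conjugating by `a ^ (i - 1)` reduces a relation between `s i` and `s (i + k)` to one between `b`
and `c = a ^ k * b * a ^ (-k)`. As `b` and `c` are involutions, `(b * c) ^ 3 = 1` is the braid
relation, `(b * c) ^ 2 = 1` is commutation and `b * c = 1` is periodicity. -/
theorem isRotatedBraidSeq_conjSeq {G : Type*} [Group G] {n : ℕ} {a b : G} (h2 : b ^ 2 = 1)
    (h3 : (b * a * b * a⁻¹) ^ 3 = 1)
    (hc : ∀ k, 2 ≤ k → k + 2 ≤ n → (b * a ^ k * b * (a ^ k)⁻¹) ^ 2 = 1)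
    (hp : b * a ^ n * b * (a ^ n)⁻¹ = 1) : IsRotatedBraidSeq n a (conjSeq a b) := by
  have hinv : b⁻¹ = b := inv_eq_of_mul_eq_one_left (by rw [← sq, h2])
  have key : ∀ i k, conjSeq a b (i + k) =
      MulAut.conj (a ^ ((i : ℤ) - 1)) (a ^ k * b * (a ^ k)⁻¹) := by
    intro i k
    rw [← conjSeq_succ_eq, conjSeq, conjSeq, ← MulAut.mul_apply, ← map_mul, ← zpow_add]
    congr 3
    push_cast
    ring
  have key0 : ∀ i, conjSeq a b i = MulAut.conj (a ^ ((i : ℤ) - 1)) b := fun _ => rfl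
  have hinv' : ∀ k, (a ^ k * b * (a ^ k)⁻¹)⁻¹ = a ^ k * b * (a ^ k)⁻¹ := fun k => by
    simp [hinv, mul_assoc]
  refine ⟨fun i => ?_, fun i => ?_, fun i k hk hkn => ?_, fun i => ?_, fun i => ?_⟩
  · rw [key0, ← map_mul, ← sq, h2, map_one]
  · rw [key, key0, ← map_mul, ← map_mul, ← map_mul, ← map_mul]
    congr 1
    have hi := hinv' 1
    rw [pow_one] at hi ⊢
    have h3' : (b * (a * b * a⁻¹)) ^ 3 = 1 := by simpa [mul_assoc] using h3
    generalize a * b * a⁻¹ = c at hi h3' ⊢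
    rw [← mul_inv_eq_one, mul_inv_rev, mul_inv_rev, hi, hinv, ← h3']
    simp only [pow_succ, pow_zero, one_mul, mul_assoc]
  · rw [key, key0, ← map_mul, ← map_mul]
    congr 1
    have hi := hinv' k
    have hc' : (b * (a ^ k * b * (a ^ k)⁻¹)) ^ 2 = 1 := by simpa [mul_assoc] using hc k hk hkn
    generalize a ^ k * b * (a ^ k)⁻¹ = c at hi hc' ⊢
    rw [← mul_inv_eq_one, mul_inv_rev, hi, hinv, ← hc']
    simp only [pow_succ, pow_zero, one_mul, mul_assoc]
  · rw [conjSeq_succ, inv_mul_cancel_right]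
  · rw [key, key0]
    congr 1
    rw [← inv_mul_eq_one, hinv', ← mul_eq_one_comm (a := b), ← hp]
    group

/-! ### The relations inside the semidirect product -/

namespace LatticeSemidirectPerm

open SemidirectProduct

/-- The points `last, 0, 1, …` in their cyclic order. -/
def point (m i : ℕ) : Fin (m + 1) := ⟨(i + m) % (m + 1), Nat.mod_lt _ m.succ_pos⟩

theorem point_succ (m i : ℕ) : point m (i + 1) = finRotate (m + 1) (point m i) := by
  rw [finRotate_apply, Fin.ext_iff, Fin.val_add, Fin.val_one', point, point]
  simp [add_right_comm]

/-- The cyclic successor inverts the enumeration `point`, so the translation at coordinate `v` is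
the one with index `v + 1`. -/
theorem point_val_succ {m : ℕ} (v : Fin (m + 1)) : point m (v + 1 : Fin (m + 1)) = v := by
  rw [Fin.ext_iff, point, Fin.val_add, Fin.val_one']
  simp only [Nat.add_mod_mod, Nat.mod_add_mod]
  rw [add_assoc, add_comm 1, Nat.add_mod_right, Nat.mod_eq_of_lt v.isLt]

theorem point_add_period (m i : ℕ) : point m (i + (m + 1)) = point m i := by
  simp only [Fin.ext_iff, point, add_right_comm i]
  exact Nat.add_mod_right _ _

theorem point_injOn (m : ℕ) : Set.InjOn (point m) (Set.Iic m) := by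
  intro i hi j hj h
  have h' := congrArg Fin.val h
  simp only [point] at h'
  have := Nat.ModEq.add_right_cancel' m h'
  exact Nat.ModEq.eq_of_lt_of_lt this (Nat.lt_succ_of_le hi) (Nat.lt_succ_of_le hj)

theorem point_ne {m i j : ℕ} (hi : i ≤ m) (hj : j ≤ m) (h : i ≠ j) : point m i ≠ point m j :=
  fun he => h (point_injOn m hi hj he)

/-- The unit translation at the coordinate `v`. -/
def unitTranslation {n : ℕ} (v : Fin n) : LatticeSemidirectPerm n :=
  inl (Pi.mulSingle v (Multiplicative.ofAdd 1))

theorem inr_mul_unitTranslation {n : ℕ} (π : Equiv.Perm (Fin n)) (v : Fin n) :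
    (inr π : LatticeSemidirectPerm n) * unitTranslation v = unitTranslation (π v) * inr π := by
  rw [← mul_inv_eq_iff_eq_mul, ← map_inv, unitTranslation, ← inl_aut, unitTranslation]
  congr 1
  funext w
  change (Pi.mulSingle v (Multiplicative.ofAdd (1 : ℤ)) : Fin n → Multiplicative ℤ) (π⁻¹ w) = _
  simp only [Pi.mulSingle_apply, Equiv.Perm.inv_eq_iff_eq]

theorem unitTranslation_commute {n : ℕ} (v w : Fin n) :
    Commute (unitTranslation v) (unitTranslation w) := by
  rw [commute_iff_eq, unitTranslation, unitTranslation, ← map_mul, mul_comm, map_mul]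

variable {m : ℕ}

/-- The enumeration `point` starts at the last coordinate precisely because `a` translates there:
removing the cycle from `a` leaves the translation at `point m 0`. -/
theorem genA_eq : genA (m + 1) = unitTranslation (point m 0) * inr (finRotate (m + 1)) := by
  ext v
  · simp only [genA, unitTranslation, mul_left, left_inl, right_inl, left_inr, map_one, mul_one,
      Pi.mulSingle_apply, point, Fin.ext_iff, zero_add, Nat.add_right_cancel_iff,
      Nat.mod_eq_of_lt m.lt_succ_self]
    split_ifs <;> rfl
  · simp [genA, unitTranslation]

theorem point_one : point m 1 = 0 := by
  simp only [Fin.ext_iff, point, add_comm 1]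
  exact Nat.mod_self _

theorem genB_eq (hm : 4 ≤ m + 1) :
    genB (m + 1) hm = inr (Equiv.swap (point m 1) (point m 2)) := by
  have h2 : point m 2 = 1 := by rw [point_succ, point_one, finRotate_apply, zero_add]
  rw [point_one, h2]
  ext v
  · simp [genB]
  · simp only [genB, right_inr]
    congr 3
    rw [Fin.ext_iff, Fin.val_one', Nat.mod_eq_of_lt (show 1 < m + 1 by omega)]

theorem genA_conj (i : ℕ) :
    genA (m + 1) * inr (Equiv.swap (point m i) (point m (i + 1))) * (genA (m + 1))⁻¹ =
      unitTranslation (point m 0) * inr (Equiv.swap (point m (i + 1)) (point m (i + 2))) *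
        (unitTranslation (point m 0))⁻¹ := by
  rw [genA_eq, point_succ m (i + 1), point_succ m i, Equiv.swap_apply_apply, ← point_succ]
  simp only [map_mul, map_inv]
  group

/-- The rotated transposition does not move `point m 0`, so it commutes with the translation part of
`a`. -/
theorem genA_conj_of_lt {i : ℕ} (hi : i + 1 < m) :
    genA (m + 1) * inr (Equiv.swap (point m i) (point m (i + 1))) * (genA (m + 1))⁻¹ =
      inr (Equiv.swap (point m (i + 1)) (point m (i + 2))) := by
  rw [genA_conj, mul_inv_eq_iff_eq_mul, inr_mul_unitTranslation,
    Equiv.swap_apply_of_ne_of_ne (point_ne (by omega) (by omega) (by omega))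
      (point_ne (by omega) (by omega) (by omega))]

theorem conjSeq_eq (hm : 4 ≤ m + 1) {i : ℕ} (hi : i < m) :
    conjSeq (genA (m + 1)) (genB (m + 1) hm) i =
      inr (Equiv.swap (point m i) (point m (i + 1))) := by
  induction i with
  | zero =>
    have h1 := conjSeq_succ (genA (m + 1)) (genB (m + 1) hm) 0
    rw [zero_add, conjSeq_one] at h1
    have h2 := (genB_eq hm).symm.trans h1
    rw [← genA_conj_of_lt (by omega)] at h2
    exact (mul_left_cancel (mul_right_cancel h2)).symm
  | succ i ih => rw [conjSeq_succ, ih (by omega), genA_conj_of_lt hi]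

/-- Going once around the cycle picks up conjugation by `T * T'`, the translations at `point 0` and
`point 1`. The transposition of these two points exchanges `T` and `T'`, hence commutes with their
product. -/
theorem conjSeq_period (hm : 4 ≤ m + 1) :
    conjSeq (genA (m + 1)) (genB (m + 1) hm) (m + 1) =
      conjSeq (genA (m + 1)) (genB (m + 1) hm) 0 := by
  obtain ⟨k, rfl⟩ : ∃ k, m = k + 1 := ⟨m - 1, by omega⟩
  rw [conjSeq_succ, conjSeq_succ, conjSeq_eq hm (by omega), conjSeq_eq hm (by omega), genA_conj]
  have hp : point (k + 1) (k + 2) = point (k + 1) 0 := by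
    simpa using point_add_period (k + 1) 0
  have hrot : finRotate (k + 1 + 1) (point (k + 1) (k + 1)) = point (k + 1) 0 := by
    rw [← point_succ, hp]
  set T := unitTranslation (point (k + 1) 0) with hT
  set T' := unitTranslation (point (k + 1) 1) with hT'
  set ρ : LatticeSemidirectPerm (k + 1 + 1) := inr (finRotate (k + 1 + 1)) with hρ
  have hA : genA (k + 1 + 1) = T * ρ := genA_eq
  have hρT : ρ * T = T' * ρ := by
    rw [hρ, hT, inr_mul_unitTranslation, ← point_succ]
  have hswap : ρ * inr (Equiv.swap (point (k + 1) (k + 1)) (point (k + 1) (k + 2))) * ρ⁻¹ =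
      inr (Equiv.swap (point (k + 1) 0) (point (k + 1) 1)) := by
    rw [hp, hρ, ← map_inv, ← map_mul, ← map_mul, ← Equiv.swap_apply_apply, hrot, ← point_succ]
  set σ : LatticeSemidirectPerm (k + 1 + 1) :=
    inr (Equiv.swap (point (k + 1) 0) (point (k + 1) 1)) with hσ
  have hσT : σ * T = T' * σ := by
    rw [hσ, hT, inr_mul_unitTranslation, Equiv.swap_apply_left]
  have hσT' : σ * T' = T * σ := by
    rw [hσ, hT', inr_mul_unitTranslation, Equiv.swap_apply_right]
  have hTT : T * T' = T' * T := unitTranslation_commute _ _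
  rw [hA, ← hswap]
  rw [← hswap] at hσT hσT'
  generalize (inr (Equiv.swap (point (k + 1) (k + 1)) (point (k + 1) (k + 2))) :
    LatticeSemidirectPerm (k + 1 + 1)) = s at *
  calc T * ρ * (T * s * T⁻¹) * (T * ρ)⁻¹ = T * (ρ * T) * s * (ρ * T)⁻¹ * T⁻¹ := by group
    _ = T * (T' * (ρ * s * ρ⁻¹)) * T'⁻¹ * T⁻¹ := by rw [hρT]; group
    _ = (T * (ρ * s * ρ⁻¹)) * (T * T'⁻¹ * T⁻¹) := by rw [← hσT]; group
    _ = ρ * s * ρ⁻¹ * (T' * T * T'⁻¹ * T⁻¹) := by rw [← hσT']; group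
    _ = ρ * s * ρ⁻¹ := by rw [← hTT]; group

/-- The product of the first `l` transpositions is the cycle through `point m 0, …, point m l`, and
this is the induction hypothesis. -/
theorem finRotate_eq_ascProd :
    finRotate (m + 1) = ascProd (fun i => Equiv.swap (point m i) (point m (i + 1))) 0 m := by
  have h : ∀ l ≤ m,
      (∀ j < l, ascProd (fun i => Equiv.swap (point m i) (point m (i + 1))) 0 l (point m j) =
        point m (j + 1)) ∧
      ascProd (fun i => Equiv.swap (point m i) (point m (i + 1))) 0 l (point m l) = point m 0 ∧
      ∀ j, l < j → j ≤ m →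
        ascProd (fun i => Equiv.swap (point m i) (point m (i + 1))) 0 l (point m j) =
          point m j := by
    intro l hl
    induction l with
    | zero => simp [ascProd]
    | succ l ih =>
      obtain ⟨h1, h2, h3⟩ := ih (by omega)
      simp only [ascProd, zero_add, Equiv.Perm.mul_apply]
      refine ⟨fun j hj => ?_, ?_, fun j hj hjm => ?_⟩
      · rcases Nat.lt_succ_iff_lt_or_eq.mp hj with hj | rfl
        · rw [Equiv.swap_apply_of_ne_of_ne (point_ne (by omega) (by omega) (by omega))
            (point_ne (by omega) (by omega) (by omega)), h1 j hj]
        · rw [Equiv.swap_apply_left, h3 _ (by omega) (by omega)]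
      · rw [Equiv.swap_apply_right, h2]
      · rw [Equiv.swap_apply_of_ne_of_ne (point_ne (by omega) (by omega) (by omega))
            (point_ne (by omega) (by omega) (by omega)), h3 j (by omega) hjm]
  obtain ⟨h1, h2, -⟩ := h m le_rfl
  ext1 v
  rw [← point_val_succ v, ← point_succ]
  rcases Nat.lt_succ_iff_lt_or_eq.mp (v + 1).isLt with hv | hv
  · rw [h1 _ hv]
  · rw [hv, h2]
    simpa using point_add_period m 0

theorem lift_relators (hm : 4 ≤ m + 1) :
    ∀ r ∈ relators (m + 1), FreeGroup.lift ![genA (m + 1), genB (m + 1) hm] r = 1 := by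
  have hconj : ∀ i, conjSeq (genA (m + 1)) (genB (m + 1) hm) (i + 1) = _ := fun i =>
    conjSeq_succ_eq (genA (m + 1)) (genB (m + 1) hm) i
  -- Shifting both indices down by one keeps them in the range where `conjSeq_eq` identifies them as
  -- transpositions. For `k = n - 2` the unshifted index `k + 1 = m` falls outside it.
  have hmul : ∀ i, conjSeq (genA (m + 1)) (genB (m + 1) hm) 1 *
      conjSeq (genA (m + 1)) (genB (m + 1) hm) (i + 1) =
      genA (m + 1) * (conjSeq (genA (m + 1)) (genB (m + 1) hm) 0 *
        conjSeq (genA (m + 1)) (genB (m + 1) hm) i) * (genA (m + 1))⁻¹ := by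
    intro i
    have h := conjSeq_succ (genA (m + 1)) (genB (m + 1) hm) 0
    rw [zero_add] at h
    rw [conjSeq_succ _ _ i, h]
    group
  rintro r ((hr | hr) | hr)
  · rcases hr with rfl | rfl
    · simp only [map_pow, FreeGroup.lift_apply_of, Matrix.cons_val_one, Matrix.cons_val_zero]
      rw [genB_eq, ← map_pow, sq, Equiv.swap_mul_self, map_one]
    · simp only [map_pow, map_mul, map_inv, FreeGroup.lift_apply_of, Matrix.cons_val_one,
        Matrix.cons_val_zero]
      have h := hconj 1
      rw [pow_one, conjSeq_eq hm (by omega)] at h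
      rw [mul_assoc, mul_assoc, ← mul_assoc (genA (m + 1)), ← h, genB_eq, ← map_mul, ← map_pow,
        Equiv.swap_comm (point m 1)]
      have h3 := Equiv.Perm.isThreeCycle_swap_mul_swap_same
        (point_ne (m := m) (i := 2) (j := 1) (by omega) (by omega) (by omega))
        (point_ne (m := m) (i := 2) (j := 3) (by omega) (by omega) (by omega))
        (point_ne (m := m) (i := 1) (j := 3) (by omega) (by omega) (by omega))
      rw [← h3.orderOf, pow_orderOf_eq_one, map_one]
  · obtain ⟨k, hk, hkm, rfl⟩ := hr
    simp only [map_pow, map_mul, map_inv, FreeGroup.lift_apply_of, Matrix.cons_val_one,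
        Matrix.cons_val_zero]
    have h := hmul k
    rw [conjSeq_one, hconj, conjSeq_eq hm (by omega), conjSeq_eq hm (by omega), ← mul_assoc,
      ← mul_assoc] at h
    rw [h, conj_pow, ← map_mul, ← map_pow]
    have hd : Equiv.Perm.Disjoint (Equiv.swap (point m 0) (point m 1))
        (Equiv.swap (point m k) (point m (k + 1))) := by
      rw [Equiv.Perm.disjoint_iff_disjoint_support,
        Equiv.Perm.support_swap (point_ne (by omega) (by omega) (by omega)),
        Equiv.Perm.support_swap (point_ne (by omega) (by omega) (by omega))]
      simp only [Finset.disjoint_insert_left, Finset.disjoint_singleton_left, Finset.mem_insert,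
        Finset.mem_singleton, not_or]
      refine ⟨⟨?_, ?_⟩, ?_, ?_⟩ <;> exact point_ne (by omega) (by omega) (by omega)
    rw [zero_add, hd.commute.mul_pow, sq, sq, Equiv.swap_mul_self, Equiv.swap_mul_self, mul_one,
      map_one, mul_one, mul_inv_cancel]
  · rw [Set.mem_singleton_iff] at hr
    subst hr
    simp only [map_pow, map_mul, map_inv, FreeGroup.lift_apply_of, Matrix.cons_val_one,
        Matrix.cons_val_zero]
    have h := hmul (m + 1)
    rw [conjSeq_one, hconj, conjSeq_period, ← mul_assoc, ← mul_assoc, conjSeq_eq hm (by omega),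
      ← map_mul, Equiv.swap_mul_self, map_one, mul_one, mul_inv_cancel] at h
    exact h

end LatticeSemidirectPerm

/-! ### The presented group is the semidirect product -/

namespace LatticeSemidirectPerm

open SemidirectProduct

/-- The homomorphism from the presented group to `ℤ^n ⋊ S_n`. -/
def presentationHom (m : ℕ) (hm : 4 ≤ m + 1) :
    PresentedGroup (relators (m + 1)) →* LatticeSemidirectPerm (m + 1) :=
  PresentedGroup.toGroup (lift_relators hm)

variable {m : ℕ}

theorem presentationHom_zero (hm : 4 ≤ m + 1) :
    presentationHom m hm (PresentedGroup.of 0) = genA (m + 1) :=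
  PresentedGroup.toGroup.of _

theorem presentationHom_one (hm : 4 ≤ m + 1) :
    presentationHom m hm (PresentedGroup.of 1) = genB (m + 1) hm :=
  PresentedGroup.toGroup.of _

/-- The Coxeter generators of the presented group. -/
def coxeterGen (m i : ℕ) : PresentedGroup (relators (m + 1)) :=
  conjSeq (PresentedGroup.of 0) (PresentedGroup.of 1) i

theorem isRotatedBraidSeq_coxeterGen (m : ℕ) :
    IsRotatedBraidSeq (m + 1) (PresentedGroup.of 0) (coxeterGen m) := by
  refine isRotatedBraidSeq_conjSeq ?_ ?_ (fun k hk hkm => ?_) ?_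
  · exact PresentedGroup.one_of_mem (Or.inl (Or.inl (Or.inl rfl)))
  · exact PresentedGroup.one_of_mem (Or.inl (Or.inl (Or.inr rfl)))
  · exact PresentedGroup.one_of_mem (Or.inl (Or.inr ⟨k, hk, hkm, rfl⟩))
  · exact PresentedGroup.one_of_mem (Or.inr rfl)

theorem closure_generators_eq_top (m : ℕ) :
    Subgroup.closure {PresentedGroup.of 0, coxeterGen m 1} =
      (⊤ : Subgroup (PresentedGroup (relators (m + 1)))) := by
  rw [coxeterGen, conjSeq_one, ← PresentedGroup.closure_range_of]
  congr 1
  ext x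
  simp [eq_comm]

theorem presentationHom_coxeterGen (hm : 4 ≤ m + 1) {i : ℕ} (hi : i < m) :
    presentationHom m hm (coxeterGen m i) =
      inr (Equiv.swap (point m i) (point m (i + 1))) := by
  rw [coxeterGen, map_conjSeq, presentationHom_zero, presentationHom_one, conjSeq_eq hm hi]

theorem ascProd_congr {G : Type*} [Group G] {s t : ℕ → G} {j l : ℕ}
    (h : ∀ i < l, s (j + i) = t (j + i)) : ascProd s j l = ascProd t j l := by
  induction l with
  | zero => rfl
  | succ l ih => rw [ascProd, ascProd, ih fun i hi => h i (by omega), h l (by omega)]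

/-- The translations in the presented group. -/
abbrev translation (m j : ℕ) : PresentedGroup (relators (m + 1)) :=
  translationSeq (m + 1) (PresentedGroup.of 0) (coxeterGen m) j

theorem translation_zero :
    translation m 0 = PresentedGroup.of 0 * (ascProd (coxeterGen m) 0 m)⁻¹ := rfl

theorem translation_succ (j : ℕ) :
    translation m (j + 1) = coxeterGen m j * translation m j * coxeterGen m j := rfl

theorem presentationHom_translation (hm : 4 ≤ m + 1) {j : ℕ} (hj : j ≤ m) :
    presentationHom m hm (translation m j) = unitTranslation (point m j) := by
  induction j with
  | zero =>
    rw [translation_zero, map_mul, map_inv, presentationHom_zero, genA_eq, mul_inv_eq_iff_eq_mul,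
      map_ascProd, finRotate_eq_ascProd, map_ascProd]
    congr 1
    exact (ascProd_congr fun i hi => presentationHom_coxeterGen hm (by omega)).symm
  | succ j ih =>
    rw [translation_succ, map_mul, map_mul, ih (by omega), presentationHom_coxeterGen hm (by omega),
      inr_mul_unitTranslation, Equiv.swap_apply_left, mul_assoc, ← map_mul, Equiv.swap_mul_self,
      map_one, mul_one]

theorem commute_translation (hm : 4 ≤ m + 1) {i j : ℕ} (hi : i ≤ m) (hj : j ≤ m) :
    Commute (translation m i) (translation m j) := by
  have h := isRotatedBraidSeq_coxeterGen m
  rcases lt_trichotomy i j with hij | rfl | hij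
  · exact h.commute_translation (by omega) hij (by omega)
  · exact Commute.refl _
  · exact (h.commute_translation (by omega) hij (by omega)).symm

theorem pairwise_commute_translation (hm : 4 ≤ m + 1) :
    Pairwise fun v w : Fin (m + 1) => ∀ x y : Multiplicative ℤ,
      Commute (zpowersHom _ (translation m (v + 1 : Fin (m + 1))) x)
        (zpowersHom _ (translation m (w + 1 : Fin (m + 1))) y) := by
  intro v w _ x y
  simp only [zpowersHom_apply]
  exact (commute_translation hm (Fin.is_le _) (Fin.is_le _)).zpow_zpow _ _

/-- The translation lattice inside the presented group. -/
def latticeHom (m : ℕ) (hm : 4 ≤ m + 1) :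
    (Fin (m + 1) → Multiplicative ℤ) →* PresentedGroup (relators (m + 1)) :=
  MonoidHom.noncommPiCoprod
    -- The index `v + 1` is computed in `Fin (m + 1)`, so the last coordinate receives the
    -- translation of index 0.
    (fun v : Fin (m + 1) => zpowersHom _ (translation m (v + 1 : Fin (m + 1))))
    (pairwise_commute_translation hm)

theorem presentationHom_latticeHom (hm : 4 ≤ m + 1) (z : Fin (m + 1) → Multiplicative ℤ) :
    presentationHom m hm (latticeHom m hm z) = inl z := by
  have h : (presentationHom m hm).comp (latticeHom m hm) = inl := by
    refine MonoidHom.pi_ext fun v k => ?_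
    rw [MonoidHom.comp_apply, latticeHom, MonoidHom.noncommPiCoprod_mulSingle, zpowersHom_apply,
      map_zpow, presentationHom_translation hm (Fin.is_le _), point_val_succ, unitTranslation,
      ← map_zpow, ← Pi.mulSingle_zpow, ← ofAdd_zsmul]
    simp
  exact DFunLike.congr_fun h z

theorem closure_translation_le (hm : 4 ≤ m + 1) :
    Subgroup.closure (translation m '' Set.Iio (m + 1)) ≤ (latticeHom m hm).range := by
  rw [Subgroup.closure_le]
  rintro _ ⟨j, hj, rfl⟩
  refine ⟨Pi.mulSingle (point m j) (Multiplicative.ofAdd 1), ?_⟩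
  have hv : ((point m j + 1 : Fin (m + 1)) : ℕ) = j := by
    refine point_injOn m (Fin.is_le _) (Nat.le_of_lt_succ hj) ?_
    rw [point_val_succ]
  rw [latticeHom, MonoidHom.noncommPiCoprod_mulSingle, zpowersHom_apply, hv]
  simp

theorem presentationHom_injective (hm : 4 ≤ m + 1) :
    Function.Injective (presentationHom m hm) := by
  have h := isRotatedBraidSeq_coxeterGen m
  rw [injective_iff_map_eq_one]
  intro g hg
  obtain ⟨t, ht, w, hw, rfl⟩ := h.exists_eq_mul (by omega) g
    (by rw [closure_generators_eq_top]; trivial)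
  obtain ⟨z, rfl⟩ := closure_translation_le hm ht
  rw [map_mul, presentationHom_latticeHom] at hg
  -- Projecting to the symmetric group kills the lattice part, so the image of `w` there is trivial.
  have hw1 : w = 1 := by
    refine h.isBraidSeq.eq_one_of_map_eq_one (rightHom.comp (presentationHom m hm))
      (p := point m) (point_injOn m) (fun i hi => ?_) le_rfl hw ?_
    · rw [MonoidHom.comp_apply, presentationHom_coxeterGen hm hi, rightHom_inr]
    · simpa using congrArg rightHom hg
  subst hw1
  rw [map_one, mul_one, ← map_one inl] at hg
  rw [inl_injective hg, map_one, mul_one]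

theorem presentationHom_surjective (hm : 4 ≤ m + 1) :
    Function.Surjective (presentationHom m hm) := by
  intro g
  -- The full cycle and an adjacent transposition generate the symmetric group. The remaining
  -- discrepancy in the lattice coordinate is corrected by `latticeHom`.
  have htop : (rightHom.comp (presentationHom m hm)).range = ⊤ := by
    rw [eq_top_iff, ← Equiv.Perm.closure_cycle_adjacent_swap
      (isCycle_finRotate_of_le (n := m + 1) (by omega))
      (support_finRotate_of_le (n := m + 1) (by omega)) (point m 1), Subgroup.closure_le]
    rintro _ (rfl | rfl)
    · exact ⟨PresentedGroup.of 0, by simp [presentationHom_zero, genA]⟩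
    · refine ⟨PresentedGroup.of 1, ?_⟩
      rw [MonoidHom.comp_apply, presentationHom_one, genB_eq, rightHom_inr, point_succ m 1]
  obtain ⟨w, hw⟩ : g.right ∈ (rightHom.comp (presentationHom m hm)).range := htop ▸ trivial
  have hw' : (presentationHom m hm w).right = g.right := hw
  refine ⟨latticeHom m hm (g.left * (presentationHom m hm w).left⁻¹) * w, ?_⟩
  rw [map_mul, presentationHom_latticeHom]
  ext v
  · simp
  · simp [hw']

end LatticeSemidirectPerm

/-! ### Units of the deformed lattice as affine permutations of the integers -/

namespace TwistedLattice

open LatticeSemidirectPerm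

theorem finRotate_zpow_modEq {n : ℕ} (k : ℤ) (v : Fin n) :
    ((((finRotate n) ^ k) v : ℕ) : ℤ) ≡ (v : ℕ) + k [ZMOD n] := by
  have h1 : ∀ v : Fin n, ((finRotate n v : ℕ) : ℤ) ≡ (v : ℕ) + 1 [ZMOD n] := by
    intro v
    have : NeZero n := ⟨by have := v.isLt; omega⟩
    rw [finRotate_apply, Fin.val_add, Fin.val_one', Nat.add_mod_mod]
    push_cast
    exact Int.mod_modEq _ _
  have h2 : ∀ v : Fin n, (((finRotate n)⁻¹ v : ℕ) : ℤ) ≡ (v : ℕ) - 1 [ZMOD n] := by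
    intro v
    have := (h1 ((finRotate n)⁻¹ v)).symm
    rw [← Equiv.Perm.mul_apply, mul_inv_cancel, Equiv.Perm.one_apply] at this
    simpa using this.sub_right 1
  induction k generalizing v with
  | zero => simp
  | succ k ih =>
    rw [zpow_add_one, Equiv.Perm.mul_apply]
    refine (ih _).trans ?_
    have := (h1 v).add_right (k : ℤ)
    rwa [add_assoc, add_comm 1] at this
  | pred k ih =>
    rw [zpow_sub_one, Equiv.Perm.mul_apply]
    refine (ih _).trans ?_
    have := (h2 v).add_right (-k : ℤ)
    rwa [sub_add_eq_add_sub, add_sub_assoc] at this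

/-- The displacement modulo `n` determines where a point goes. This gives the multiplicativity of
`ofSemidirect` and recovers the permutation from its image. -/
theorem inv_finRotate_zpow_eq {n : ℕ} {k : ℤ} {v w : Fin n} {q : ℤ}
    (h : k = (v : ℕ) - (w : ℕ) - n * q) : (((finRotate n)⁻¹) ^ k) v = w := by
  have h1 := finRotate_zpow_modEq (-k) v
  rw [inv_zpow']
  have h2 : (((finRotate n ^ (-k)) v : ℕ) : ℤ) ≡ (w : ℕ) [ZMOD n] := by
    refine h1.trans ?_
    rw [h, Int.modEq_iff_dvd]
    exact ⟨-q, by ring⟩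
  rw [Int.natCast_modEq_iff] at h2
  exact Fin.ext (Nat.ModEq.eq_of_lt_of_lt h2 (Fin.isLt _) (Fin.isLt _))

/-- The pair `(z, s)` acts on `ℤ` as an affine permutation; its displacement is an element of the
deformed lattice. -/
def ofSemidirect (n : ℕ) :
    LatticeSemidirectPerm n →* TwistedLattice (finRotate n)⁻¹ where
  toFun g := ⟨fun v => (v : ℕ) - (g.right⁻¹ v : ℕ) - n * (g.left v).toAdd⟩
  map_one' := by
    ext v
    simp [one_val]
  map_mul' g h := by
    ext v
    rw [mul_val]
    dsimp only
    rw [inv_finRotate_zpow_eq rfl]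
    have : (g * h).left v = g.left v * h.left (g.right⁻¹ v) := rfl
    rw [this, SemidirectProduct.mul_right, mul_inv_rev, Equiv.Perm.mul_apply, toAdd_mul]
    ring

theorem ofSemidirect_val {n : ℕ} (g : LatticeSemidirectPerm n) (v : Fin n) :
    (ofSemidirect n g).val v = (v : ℕ) - (g.right⁻¹ v : ℕ) - n * (g.left v).toAdd := rfl

theorem ofSemidirect_injective (n : ℕ) : Function.Injective (ofSemidirect n) := by
  intro g h hgh
  have hv : ∀ v, (ofSemidirect n g).val v = (ofSemidirect n h).val v := fun v => by rw [hgh]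
  have hr : g.right = h.right := by
    rw [← inv_inj]
    ext1 v
    rw [← inv_finRotate_zpow_eq (ofSemidirect_val g v), hv,
      inv_finRotate_zpow_eq (ofSemidirect_val h v)]
  refine SemidirectProduct.ext (funext fun v => ?_) hr
  have := hv v
  rw [ofSemidirect_val, ofSemidirect_val, hr] at this
  have hn : (n : ℤ) ≠ 0 := by have := v.isLt; omega
  exact Multiplicative.toAdd.injective (mul_left_cancel₀ hn (by linarith))

/-- The permutation of the points induced by an invertible element. -/
def permOfUnit {V : Type*} {τ : Equiv.Perm V} (u : (TwistedLattice τ)ˣ) : Equiv.Perm V where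
  toFun v := (τ ^ (u : TwistedLattice τ).val v) v
  invFun v := (τ ^ (↑u⁻¹ : TwistedLattice τ).val v) v
  left_inv v := by
    have h := congrArg (fun f : TwistedLattice τ => f.val v) u.mul_inv
    simp only [mul_val, one_val] at h
    dsimp only
    rw [← Equiv.Perm.mul_apply, ← zpow_add, add_comm, h, zpow_zero, Equiv.Perm.one_apply]
  right_inv v := by
    have h := congrArg (fun f : TwistedLattice τ => f.val v) u.inv_mul
    simp only [mul_val, one_val] at h
    dsimp only
    rw [← Equiv.Perm.mul_apply, ← zpow_add, add_comm, h, zpow_zero, Equiv.Perm.one_apply]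

theorem exists_ofSemidirect_eq {n : ℕ} (u : DeformedGroup n) :
    ∃ g, ofSemidirect n g = u := by
  -- The displaced point `v - u(v)` is congruent to its residue `permOfUnit u v` modulo `n`. The
  -- quotient, with its sign reversed to match `ofSemidirect`, is the lattice coordinate.
  have hd : ∀ v : Fin n, ∃ q : ℤ,
      (v : ℕ) - (permOfUnit u v : ℕ) - (u : TwistedLattice (finRotate n)⁻¹).val v = n * q := by
    intro v
    have h := finRotate_zpow_modEq (-(u : TwistedLattice (finRotate n)⁻¹).val v) v
    rw [← inv_zpow', Int.modEq_iff_dvd] at h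
    obtain ⟨q, hq⟩ := h
    refine ⟨q, ?_⟩
    rw [← hq, permOfUnit, Equiv.coe_fn_mk]
    ring
  choose q hq using hd
  refine ⟨⟨fun v => Multiplicative.ofAdd (q v), (permOfUnit u)⁻¹⟩, ?_⟩
  ext v
  rw [ofSemidirect_val]
  simp only [inv_inv, toAdd_ofAdd]
  linarith [hq v]

theorem nonempty_deformedGroup_mulEquiv (n : ℕ) :
    Nonempty (DeformedGroup n ≃* LatticeSemidirectPerm n) := by
  refine ⟨(MulEquiv.ofBijective (ofSemidirect n).toHomUnits ⟨fun g h hgh => ?_, fun u => ?_⟩).symm⟩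
  · exact ofSemidirect_injective n (congrArg Units.val hgh)
  · obtain ⟨g, hg⟩ := exists_ofSemidirect_eq u
    exact ⟨g, Units.ext hg⟩

end TwistedLattice

theorem theorem1 (n : ℕ) (hn : 4 ≤ n) :
    Nonempty (DeformedGroup n ≃* LatticeSemidirectPerm n) ∧
    Subgroup.closure {genA n, genB n hn} = (⊤ : Subgroup (LatticeSemidirectPerm n)) ∧
    ∃ e : PresentedGroup (relators n) ≃* LatticeSemidirectPerm n,
      e (PresentedGroup.of 0) = genA n ∧ e (PresentedGroup.of 1) = genB n hn := by
  obtain ⟨m, rfl⟩ : ∃ m, n = m + 1 := ⟨n - 1, by omega⟩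
  refine ⟨TwistedLattice.nonempty_deformedGroup_mulEquiv _, ?_,
    MulEquiv.ofBijective (LatticeSemidirectPerm.presentationHom m hn)
      ⟨LatticeSemidirectPerm.presentationHom_injective hn,
        LatticeSemidirectPerm.presentationHom_surjective hn⟩,
    LatticeSemidirectPerm.presentationHom_zero hn, LatticeSemidirectPerm.presentationHom_one hn⟩
  have h := LatticeSemidirectPerm.closure_generators_eq_top m
  have h' := congrArg (Subgroup.map (LatticeSemidirectPerm.presentationHom m hn)) h
  rw [MonoidHom.map_closure, ← MonoidHom.range_eq_map,
    MonoidHom.range_eq_top.mpr (LatticeSemidirectPerm.presentationHom_surjective hn),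
    Set.image_pair, LatticeSemidirectPerm.coxeterGen, conjSeq_one,
    LatticeSemidirectPerm.presentationHom_zero, LatticeSemidirectPerm.presentationHom_one] at h'
  exact h'
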